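/- Fix constants $D\in\mathbb{N}$ with $D\ge 1$, $c>0$, $C$ and $B$. Let $\mathcal{R}$ be a family of subsets (ranges) of $\mathbb{R}^D$. Suppose that for every set $P\subset\mathbb{R}^D$ of $n$ points there is a pointer-machine data structure storing $P$ that uses at most $S(n)$ space and, for every $R\in\mathcal{R}$, reports $P\cap R$ in time at most $Q(n)+C\cdot k$, where $k=|P\cap R|$. Here a data structure is a rooted directed graph of cells, each holding at most one point and at most two pointers; its space is the number of cells. A query starts by visiting the root (at cost one). At unit cost per operation it may follow a pointer stored in a visited cell, create a new empty cell, overwrite a pointer of a visited cell (by nil, a pointer to a visited cell, or a copy of a pointer in a visited cell), overwrite or erase the point in a visited cell (overwriting only by a point held in a visited cell), or report a point held in a visited cell. All other computation is free. Suppose further that there are a hypercube $\mathcal{C}^D\subset\mathbb{R}^D$ of side length $|l|>0$ and $m=n^c$ (rounded up or down to an integer) Lebesgue measurable ranges $R_1,\dots,R_m\in\mathcal{R}$ such that, with $\mu^D$ the Lebesgue measure and $\log$ the logarithm to base $2$, (i) $\mu^D(R_i\cap\mathcal{C}^D)\ge 4c\,|l|^D\,Q(n)/n$ for all $i$; and (ii)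 $\mu^D(R_i\cap R_j\cap\mathcal{C}^D)\le B\cdot |l|^D/(n2^{\sqrt{\log n}})$ for all $i\ne j$. Then $$S(n)=\Omega\!\left(\frac{m\,Q(n)}{2^{O(\sqrt{\log n})}}\right).$$ That is, there are $\delta>0$, $A\in\mathbb{R}$ and $n_0\in\mathbb{N}$, depending only on $D,c,C,B$, such that for every $n\ge n_0$ for which all of the above holds, $S(n)\ge \delta\, m\,Q(n)/2^{A\sqrt{\log n}}$. -/

import Mathlib

open MeasureTheory

namespace RangeReporting

/-- A data structure on a pointer machine. Its memory is a finite set of cells (named by natural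
numbers), one of which is the root. A cell holds at most one input element and two pointers
(`next v false` and `next v true`), each of which is nil or the name of a cell. -/
structure PointerStructure (α : Type*) where
  cells : Finset ℕ
  root : ℕ
  root_mem : root ∈ cells
  label : ℕ → Option α
  next : ℕ → Bool → Option ℕ
  next_mem : ∀ v ∈ cells, ∀ b w, next v b = some w → w ∈ cells

/-- The space of a data structure is its number of cells. -/
def PointerStructure.space {α : Type*} (G : PointerStructure α) : ℕ := G.cells.card

/-- A configuration of the machine while it answers a query: the allocated cells with their
contents, the cells visited so far, and the elements reported so far. -/
structure Config (α : Type*) where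
  alloc : Set ℕ
  label : ℕ → Option α
  next : ℕ → Bool → Option ℕ
  visited : Set ℕ
  output : Set α

/-- A query starts with the root as the only visited cell. -/
def PointerStructure.init {α : Type*} (G : PointerStructure α) : Config α where
  alloc := G.cells
  label := G.label
  next := G.next
  visited := {G.root}
  output := ∅

/-- One step of the machine. There is no address arithmetic: a cell of the data structure is
reached only by following a pointer that is stored in a visited cell. -/
inductive Step {α : Type*} : Config α → Config α → Prop
  /-- Follow a pointer of a visited cell. -/
  | follow (σ : Config α) (v : ℕ) (b : Bool) (w : ℕ) (hv : v ∈ σ.visited)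
      (hw : σ.next v b = some w) :
      Step σ { σ with visited := insert w σ.visited }
  /-- Create a new empty cell. -/
  | create (σ : Config α) (v : ℕ) (hv : v ∉ σ.alloc) :
      Step σ { σ with
        alloc := insert v σ.alloc
        visited := insert v σ.visited
        label := Function.update σ.label v none
        next := Function.update σ.next v (fun _ => none) }
  /-- Overwrite a pointer of a visited cell by nil, by a pointer to a visited cell, or by a copy
  of a pointer stored in a visited cell. -/
  | setPointer (σ : Config α) (v : ℕ) (b : Bool) (x : Option ℕ) (hv : v ∈ σ.visited)
      (hx : ∀ w, x = some w → w ∈ σ.visited ∨ ∃ u ∈ σ.visited, ∃ b', σ.next u b' = some w) :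
      Step σ { σ with next := Function.update σ.next v (Function.update (σ.next v) b x) }
  /-- Erase the element in a visited cell, or overwrite it by a copy of the element in a
  visited cell. -/
  | setLabel (σ : Config α) (v : ℕ) (x : Option α) (hv : v ∈ σ.visited)
      (hx : ∀ p, x = some p → ∃ u ∈ σ.visited, σ.label u = some p) :
      Step σ { σ with label := Function.update σ.label v x }
  /-- Report the element held by a visited cell. -/
  | report (σ : Config α) (v : ℕ) (p : α) (hv : v ∈ σ.visited) (hp : σ.label v = some p) :
      Step σ { σ with output := insert p σ.output }

/-- `G.RunsTo t σ`: some execution on `G` of time `t` ends in the configuration `σ`. Visiting the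
root takes one unit of time, as does every step. The choice of the steps is free: all other
computation, and any dependence on the query, is not charged. -/
inductive PointerStructure.RunsTo {α : Type*} (G : PointerStructure α) : ℕ → Config α → Prop
  | start : G.RunsTo 1 G.init
  | step {t : ℕ} {σ τ : Config α} (h : G.RunsTo t σ) (hs : Step σ τ) : G.RunsTo (t + 1) τ

/-- Range reporting for the family `𝓡` of ranges on inputs of `n` points can be solved by a
pointer machine with space `S` and query time `Q + C * k`, where `k` is the output size: every set
`P` of `n` points can be stored in a data structure with at most `S` cells, such that every query
`R ∈ 𝓡` is answered by an execution that reports exactly the points of `P ∩ R` within the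
time bound. -/
def Admits {E : Type*} (𝓡 : Set (Set E)) (n : ℕ) (S Q C : ℝ) : Prop :=
  ∀ P : Finset E, P.card = n →
    ∃ G : PointerStructure E, (G.space : ℝ) ≤ S ∧
      ∀ R ∈ 𝓡, ∃ (t : ℕ) (σ : Config E), G.RunsTo t σ ∧ σ.output = ↑P ∩ R ∧
        (t : ℝ) ≤ Q + C * (Set.ncard ((↑P : Set E) ∩ R) : ℝ)

/-- `K` is a (closed, arbitrarily placed and rotated) hypercube of side length `l`. -/
def IsHypercube {D : ℕ} (K : Set (EuclideanSpace ℝ (Fin D))) (l : ℝ) : Prop :=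
  ∃ (a : EuclideanSpace ℝ (Fin D))
    (b : OrthonormalBasis (Fin D) ℝ (EuclideanSpace ℝ (Fin D))),
    K = {x | ∀ i, b.repr (x - a) i ∈ Set.Icc 0 l}

end RangeReporting

/-! ### Pointer-machine executions and trees of pointers. -/

namespace RangeReporting

/-! Place `n` uniform random points in the cube. A range then expects at least `4cQ` points, while a
pair of ranges expects at most `B / 2^L` common points, where `L = √(log n)`. The mean of `2^(L * |P
∩ R i ∩ R j|)` is thus at most `exp B`, and that of `2^(-|P ∩ R i|)` is at most `exp (-2cQ)`.
Derandomizing a weighted sum of both (`IsHypercube.exists_points`) yields one set `P` for which the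
pair sum is `O(m^2)` and, if `Q ≥ 1`, a constant fraction of the ranges contain at least `cQ`
points. As `m` is about `n^c`, the pair sum forces any two ranges to share at most `r = O(L)` points
of `P`. If `Q < 1`, all outputs are nonempty, because a query takes time at least one, and this is
enough.

Changes made to memory during a query create no new knowledge: what is reported lies in a tree of
original pointers hanging at the root, no larger than the running time (`RunsTo.exists_tree`). An
output of size `k ≥ βQ` therefore comes from a tree of at most `H * k` nodes. If also `k ≥ 4r`, at
least `k / (2a)` trees of at most `a = O(r)` nodes, hanging at arbitrary cells, find more than `r`
of its elements (`card_le_mul_card_richTrees`). Each cell carries `2^O(r)` tree shapes, and each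
such tree is rich for `2^O(r)` outputs at most, since distinct ranges share at most `r` points.
Double counting bounds the total output size by the space times `2^O(r)` (`sum_card_le_mul_space`).

Since no lower bound on `Q` is assumed, outputs smaller than `4r` are discarded separately.
Executions of time `O(k)` have only `2^O(k)` outputs, so too many small outputs would make many
pairs coincide and overload the pair sum (`card_filter_lt_le`). -/

open BinaryTree in
/-- The elements found in the cells that are reached from `x` along the paths of the binary tree
`T`; paths that run into nil are cut there. -/
noncomputable def PointerStructure.elems {α : Type*} (G : PointerStructure α) :
    BinaryTree Unit → Option ℕ → Set α
  | nil, _ => ∅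
  | node _ _ _, none => ∅
  | node _ l r, some v =>
    {p | G.label v = some p} ∪ (G.elems l (G.next v false) ∪ G.elems r (G.next v true))

/-- The cells that are reached from `x` along the paths of the binary tree `T`. -/
def PointerStructure.reach {α : Type*} (G : PointerStructure α) :
    BinaryTree Unit → Option ℕ → Set ℕ
  | .nil, _ => ∅
  | .node _ _ _, none => ∅
  | .node _ l r, some v => {v} ∪ (G.reach l (G.next v false) ∪ G.reach r (G.next v true))

namespace PointerStructure

variable {α : Type*} (G : PointerStructure α)

@[simp] lemma elems_none (T : BinaryTree Unit) : G.elems T none = ∅ := by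
  cases T <;> rfl

lemma mem_elems_of_mem_reach {T : BinaryTree Unit} {x : Option ℕ} {u : ℕ} {p : α}
    (hu : u ∈ G.reach T x) (hp : G.label u = some p) : p ∈ G.elems T x := by
  induction T generalizing x with
  | nil => simp [reach] at hu
  | node a l r ihl ihr =>
    cases x with
    | none => simp [reach] at hu
    | some v =>
      simp only [reach, elems, Set.mem_union, Set.mem_singleton_iff, Set.mem_ofPred_eq] at hu ⊢
      rcases hu with rfl | hu | hu
      · exact Or.inl hp
      · exact Or.inr (Or.inl (ihl hu))
      · exact Or.inr (Or.inr (ihr hu))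

/-- A tree grows by one node when a pointer of a reached cell is followed. -/
lemma exists_reach_insert {T : BinaryTree Unit} {x : Option ℕ} {v w : ℕ} {b : Bool}
    (hv : v ∈ G.reach T x) (hw : G.next v b = some w) :
    ∃ T' : BinaryTree Unit, T'.numNodes ≤ T.numNodes + 1 ∧ insert w (G.reach T x) ⊆ G.reach T' x := by
  induction T generalizing x with
  | nil => simp [reach] at hv
  | node a l r ihl ihr =>
    cases x with
    | none => simp [reach] at hv
    | some y =>
      simp only [reach, Set.mem_union, Set.mem_singleton_iff] at hv
      -- A nonempty subtree hanging at `w` already reaches `w`; only an empty one has to be replaced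
      -- by a single node.
      have extend : ∀ (T : BinaryTree Unit), ∃ T' : BinaryTree Unit,
          T'.numNodes ≤ T.numNodes + 1 ∧ insert w (G.reach T (some w)) ⊆ G.reach T' (some w) := by
        intro T
        cases T with
        | nil => exact ⟨.node () .nil .nil, by simp [BinaryTree.numNodes], by simp [reach]⟩
        | node a l r => exact ⟨.node a l r, by simp, by simp [reach]⟩
      rcases hv with rfl | hv | hv
      · cases b with
        | false =>
          obtain ⟨l', hl, hs⟩ := extend l
          refine ⟨.node a l' r, by simp only [BinaryTree.numNodes]; omega, ?_⟩
          intro z hz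
          have := @hs z
          simp only [reach, hw, Set.mem_insert_iff, Set.mem_union, Set.mem_singleton_iff] at *
          tauto
        | true =>
          obtain ⟨r', hl, hs⟩ := extend r
          refine ⟨.node a l r', by simp only [BinaryTree.numNodes]; omega, ?_⟩
          intro z hz
          have := @hs z
          simp only [reach, hw, Set.mem_insert_iff, Set.mem_union, Set.mem_singleton_iff] at *
          tauto
      · obtain ⟨l', hl, hs⟩ := ihl hv
        refine ⟨.node a l' r, by simp only [BinaryTree.numNodes]; omega, ?_⟩
        intro z hz
        have := @hs z
        simp only [reach, Set.mem_insert_iff, Set.mem_union, Set.mem_singleton_iff] at *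
        tauto
      · obtain ⟨r', hl, hs⟩ := ihr hv
        refine ⟨.node a l r', by simp only [BinaryTree.numNodes]; omega, ?_⟩
        intro z hz
        have := @hs z
        simp only [reach, Set.mem_insert_iff, Set.mem_union, Set.mem_singleton_iff] at *
        tauto

/-- The relation between a configuration and the set `V` of visited cells of the original data
structure: everything the machine knows stems from `V`. -/
structure Tracks (V : Set ℕ) (σ : Config α) : Prop where
  cells_subset : (G.cells : Set ℕ) ⊆ σ.alloc
  visited_cells : ∀ v ∈ σ.visited, v ∈ G.cells → v ∈ V
  label_unvisited : ∀ v ∈ G.cells, v ∉ σ.visited → σ.label v = G.label v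
  next_unvisited : ∀ v ∈ G.cells, v ∉ σ.visited → σ.next v = G.next v
  label_visited : ∀ v ∈ σ.visited, ∀ p, σ.label v = some p → ∃ u ∈ V, G.label u = some p
  next_visited : ∀ v ∈ σ.visited, ∀ b w, σ.next v b = some w →
    w ∈ σ.visited ∨ w ∈ G.cells ∧ ∃ u ∈ V, ∃ b', G.next u b' = some w
  output_label : ∀ p ∈ σ.output, ∃ u ∈ V, G.label u = some p

variable {G}

lemma Tracks.mono {V W : Set ℕ} {σ : Config α} (h : G.Tracks V σ) (hVW : V ⊆ W) :
    G.Tracks W σ where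
  cells_subset := h.cells_subset
  visited_cells v hv hc := hVW (h.visited_cells v hv hc)
  label_unvisited := h.label_unvisited
  next_unvisited := h.next_unvisited
  label_visited v hv p hp := (h.label_visited v hv p hp).imp fun _ hu => ⟨hVW hu.1, hu.2⟩
  next_visited v hv b w hw := (h.next_visited v hv b w hw).imp_right
    fun hu => ⟨hu.1, hu.2.imp fun _ hu => ⟨hVW hu.1, hu.2⟩⟩
  output_label p hp := (h.output_label p hp).imp fun _ hu => ⟨hVW hu.1, hu.2⟩

lemma tracks_init : G.Tracks {G.root} G.init where
  cells_subset := subset_rfl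
  visited_cells v hv _ := hv
  label_unvisited _ _ _ := rfl
  next_unvisited _ _ _ := rfl
  label_visited v hv p hp := ⟨v, hv, hp⟩
  next_visited v hv b w hw := by
    obtain rfl : v = G.root := hv
    exact Or.inr ⟨G.next_mem _ G.root_mem b w hw, _, rfl, b, hw⟩
  output_label p hp := hp.elim

/-- A step visits at most one more cell of the original data structure, along one of its
pointers. -/
lemma Tracks.step {V : Set ℕ} {σ τ : Config α} (h : G.Tracks V σ) (hs : Step σ τ) :
    G.Tracks V τ ∨ ∃ u ∈ V, ∃ b w, G.next u b = some w ∧ G.Tracks (insert w V) τ := by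
  cases hs with
  | follow v b w hv hw =>
    -- The followed pointer may have been written during the query. The invariant traces it to an
    -- original pointer of some `u ∈ V`, so `V` grows along an edge of the original graph.
    rcases h.next_visited v hv b w hw with hwv | ⟨hwc, u, hu, b', hub⟩
    · left
      rwa [Set.insert_eq_of_mem hwv]
    · by_cases hwv : w ∈ σ.visited
      · left
        rwa [Set.insert_eq_of_mem hwv]
      refine Or.inr ⟨u, hu, b', w, hub, ?_⟩
      have h' := h.mono (Set.subset_insert w V)
      refine ⟨h'.cells_subset, ?_, ?_, ?_, ?_, ?_, h'.output_label⟩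
      · rintro y (rfl | hy) hc
        · exact Set.mem_insert _ _
        · exact h'.visited_cells y hy hc
      · exact fun y hy hn => h.label_unvisited y hy fun hh => hn (Or.inr hh)
      · exact fun y hy hn => h.next_unvisited y hy fun hh => hn (Or.inr hh)
      · rintro y (rfl | hy) p hp
        · exact ⟨y, Set.mem_insert _ _, by rw [← h.label_unvisited y hwc hwv]; exact hp⟩
        · exact h'.label_visited y hy p hp
      · rintro y (rfl | hy) b₁ w₁ hp
        · have hp' : G.next y b₁ = some w₁ := by
            rw [← h.next_unvisited y hwc hwv]; exact hp
          exact Or.inr ⟨G.next_mem y hwc b₁ w₁ hp', y, Set.mem_insert _ _, b₁, hp'⟩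
        · exact (h'.next_visited y hy b₁ w₁ hp).imp_left Or.inr
  | create v hv =>
    left
    -- Original cells stay allocated, so the name of a new cell never collides with theirs.
    have hne : ∀ y ∈ G.cells, y ≠ v := fun y hy e => hv (e ▸ h.cells_subset hy)
    refine ⟨h.cells_subset.trans (Set.subset_insert _ _), ?_, ?_, ?_, ?_, ?_, h.output_label⟩
    · rintro y (rfl | hy) hc
      · exact (hne y hc rfl).elim
      · exact h.visited_cells y hy hc
    · intro y hy hn
      simpa [Function.update_of_ne (hne y hy)] using
        h.label_unvisited y hy fun hh => hn (Or.inr hh)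
    · intro y hy hn
      simpa [Function.update_of_ne (hne y hy)] using
        h.next_unvisited y hy fun hh => hn (Or.inr hh)
    · intro y hy p hp
      by_cases e : y = v
      · subst e; simp at hp
      · simp only [Function.update_of_ne e] at hp
        exact h.label_visited y (hy.resolve_left e) p hp
    · intro y hy b w hp
      by_cases e : y = v
      · subst e; simp at hp
      · simp only [Function.update_of_ne e] at hp
        exact (h.next_visited y (hy.resolve_left e) b w hp).imp_left Or.inr
  | setPointer v b x hv hx =>
    left
    refine ⟨h.cells_subset, h.visited_cells, h.label_unvisited, ?_, h.label_visited, ?_,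
      h.output_label⟩
    · intro y hy hn
      have e : y ≠ v := fun e => hn (e ▸ hv)
      simpa [Function.update_of_ne e] using h.next_unvisited y hy hn
    · intro y hy b₁ w hp
      by_cases e : y = v
      · subst e
        by_cases eb : b₁ = b
        · subst eb
          simp only [Function.update_self] at hp
          rcases hx w hp with hw | ⟨u, hu, b', hub⟩
          · exact Or.inl hw
          · exact h.next_visited u hu b' w hub
        · simp only [Function.update_self, Function.update_of_ne eb] at hp
          exact h.next_visited y hy b₁ w hp
      · simp only [Function.update_of_ne e] at hp
        exact h.next_visited y hy b₁ w hp
  | setLabel v x hv hx =>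
    left
    refine ⟨h.cells_subset, h.visited_cells, ?_, h.next_unvisited, ?_, h.next_visited,
      h.output_label⟩
    · intro y hy hn
      have e : y ≠ v := fun e => hn (e ▸ hv)
      simpa [Function.update_of_ne e] using h.label_unvisited y hy hn
    · intro y hy p hp
      by_cases e : y = v
      · subst e
        simp only [Function.update_self] at hp
        obtain ⟨u, hu, hup⟩ := hx p hp
        exact h.label_visited u hu p hup
      · simp only [Function.update_of_ne e] at hp
        exact h.label_visited y hy p hp
  | report v p hv hp =>
    left
    refine ⟨h.cells_subset, h.visited_cells, h.label_unvisited, h.next_unvisited,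
      h.label_visited, h.next_visited, ?_⟩
    rintro q (rfl | hq)
    · exact h.label_visited v hv _ hp
    · exact h.output_label q hq

/-- An execution of time `t` reports only elements from a tree of at most `t` cells that hangs
at the root. -/
theorem RunsTo.exists_tree {t : ℕ} {σ : Config α} (h : G.RunsTo t σ) :
    ∃ T : BinaryTree Unit, T.numNodes ≤ t ∧ σ.output ⊆ G.elems T (some G.root) := by
  suffices H : ∃ T : BinaryTree Unit, T.numNodes ≤ t ∧
      G.Tracks (G.reach T (some G.root)) σ by
    obtain ⟨T, hT, ht⟩ := H
    refine ⟨T, hT, fun p hp => ?_⟩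
    obtain ⟨u, hu, hup⟩ := ht.output_label p hp
    exact G.mem_elems_of_mem_reach hu hup
  induction h with
  | start =>
    refine ⟨.node () .nil .nil, by simp [BinaryTree.numNodes], ?_⟩
    simpa [reach] using G.tracks_init
  | step h hs ih =>
    obtain ⟨T, hT, ht⟩ := ih
    rcases ht.step hs with ht | ⟨u, hu, b, w, hub, ht⟩
    · exact ⟨T, by omega, ht⟩
    · obtain ⟨T', hT', hr⟩ := G.exists_reach_insert hu hub
      exact ⟨T', by omega, ht.mono hr⟩

/-- The cost of visiting the root is what forces nonempty outputs when `Q < 1`. -/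
lemma RunsTo.one_le {t : ℕ} {σ : Config α} (h : G.RunsTo t σ) : 1 ≤ t := by
  cases h <;> omega

end PointerStructure

end RangeReporting

/-! ### Decomposing a tree into small trees that find many output elements. -/

namespace RangeReporting

/-- The binary trees with at most `a` nodes. -/
def treesOfNumNodesLE (a : ℕ) : Finset (BinaryTree Unit) :=
  (Finset.range (a + 1)).biUnion BinaryTree.treesOfNumNodesEq

@[simp] lemma mem_treesOfNumNodesLE {a : ℕ} {T : BinaryTree Unit} :
    T ∈ treesOfNumNodesLE a ↔ T.numNodes ≤ a := by
  simp [treesOfNumNodesLE, BinaryTree.mem_treesOfNumNodesEq]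

/-- Catalan numbers are at most central binomial coefficients, hence at most `4 ^ i`; the sum is
geometric. -/
lemma card_treesOfNumNodesLE (a : ℕ) : (treesOfNumNodesLE a).card ≤ 4 ^ (a + 1) := by
  calc (treesOfNumNodesLE a).card
      ≤ ∑ i ∈ Finset.range (a + 1), (BinaryTree.treesOfNumNodesEq i).card :=
        Finset.card_biUnion_le
    _ ≤ ∑ i ∈ Finset.range (a + 1), 4 ^ i := by
        refine Finset.sum_le_sum fun i _ => ?_
        rw [BinaryTree.treesOfNumNodesEq_card_eq_catalan, catalan_eq_centralBinom_div]
        exact (Nat.div_le_self _ _).trans (Nat.centralBinom_le_four_pow i)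
    _ ≤ 4 ^ (a + 1) := (Nat.geomSum_lt (by norm_num) fun k hk => by simpa using hk).le

namespace PointerStructure

open scoped Classical in
/-- The elements of `O` among those found along `T` from `x`. -/
noncomputable def found {α : Type*} (G : PointerStructure α) (O : Finset α)
    (T : BinaryTree Unit) (x : Option ℕ) : Finset α :=
  O.filter (· ∈ G.elems T x)

variable {α : Type*} {G : PointerStructure α}

@[simp] lemma mem_found {O : Finset α} {T : BinaryTree Unit} {x : Option ℕ} {p : α} :
    p ∈ G.found O T x ↔ p ∈ O ∧ p ∈ G.elems T x := by
  classical simp [found]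

@[simp] lemma found_none (O : Finset α) (T : BinaryTree Unit) : G.found O T none = ∅ := by
  ext; simp

@[simp] lemma found_nil (O : Finset α) (x : Option ℕ) : G.found O .nil x = ∅ := by
  ext; simp [elems]

lemma card_found_le (O : Finset α) (T : BinaryTree Unit) (x : Option ℕ) :
    (G.found O T x).card ≤ T.numNodes := by
  classical
  induction T generalizing x with
  | nil => simp
  | node a l r ihl ihr =>
    cases x with
    | none => simp
    | some v =>
      have hsub : G.found O (.node a l r) (some v) ⊆
          (G.label v).toFinset ∪ (G.found O l (G.next v false) ∪ G.found O r (G.next v true)) := by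
        intro p hp
        simp only [mem_found, elems, Finset.mem_union, Set.mem_union, Set.mem_ofPred_eq,
          Option.mem_toFinset, Option.mem_def] at hp ⊢
        tauto
      have h1 : (G.label v).toFinset.card ≤ 1 := by
        cases G.label v <;> simp
      have h2 := Finset.card_le_card hsub
      have h3 := Finset.card_union_le (G.label v).toFinset
        (G.found O l (G.next v false) ∪ G.found O r (G.next v true))
      have h4 := Finset.card_union_le (G.found O l (G.next v false)) (G.found O r (G.next v true))
      have := ihl (G.next v false)
      have := ihr (G.next v true)
      simp only [BinaryTree.numNodes]
      omega

lemma finite_elems (T : BinaryTree Unit) (x : Option ℕ) : (G.elems T x).Finite := by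
  induction T generalizing x with
  | nil => simp [elems]
  | node a l r ihl ihr =>
    cases x with
    | none => simp
    | some v =>
      refine Set.Finite.union ?_ ((ihl _).union (ihr _))
      exact Set.Subsingleton.finite fun p hp q hq => by
        simpa using (Set.mem_ofPred_eq.symm.mp hp).symm.trans hq

/-- If every tree of at most `2 * h + 1` nodes finds at most `r` elements of `O`, then, up to a
tree of at most `h` nodes, a tree of `N` nodes finds at most `r * N / h` elements of `O`. -/
lemma exists_residual_tree {O : Finset α} {r h : ℕ}
    (hO : ∀ z ∈ G.cells, ∀ T : BinaryTree Unit, T.numNodes ≤ 2 * h + 1 →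
      (G.found O T (some z)).card ≤ r)
    (T : BinaryTree Unit) (x : Option ℕ) (hx : ∀ z, x = some z → z ∈ G.cells) :
    ∃ (T' : BinaryTree Unit) (X : Set α), T'.numNodes ≤ h ∧ X.Finite ∧
      ↑(G.found O T x) ⊆ ↑(G.found O T' x) ∪ X ∧
      h * X.ncard + r * T'.numNodes ≤ r * T.numNodes := by
  induction T generalizing x with
  | nil => exact ⟨.nil, ∅, by simp [BinaryTree.numNodes], by simp, by simp, by simp⟩
  | node a T₁ T₂ ih₁ ih₂ =>
    cases x with
    | none => exact ⟨.nil, ∅, by simp [BinaryTree.numNodes], by simp, by simp,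
        by simp [BinaryTree.numNodes]⟩
    | some v =>
      have hv := hx v rfl
      obtain ⟨S₁, X₁, hs₁, hf₁, hc₁, hn₁⟩ := ih₁ (G.next v false) (G.next_mem v hv false)
      obtain ⟨S₂, X₂, hs₂, hf₂, hc₂, hn₂⟩ := ih₂ (G.next v true) (G.next_mem v hv true)
      have hcov : (↑(G.found O (.node a T₁ T₂) (some v)) : Set α) ⊆
          ↑(G.found O (.node a S₁ S₂) (some v)) ∪ (X₁ ∪ X₂) := by
        intro p hp
        have h₁ := @hc₁ p
        have h₂ := @hc₂ p
        simp only [Finset.mem_coe, mem_found, elems, Set.mem_union, Set.mem_ofPred_eq] at *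
        tauto
      have hcard : (X₁ ∪ X₂).ncard ≤ X₁.ncard + X₂.ncard := Set.ncard_union_le _ _
      have hbound : h * (X₁ ∪ X₂).ncard + r * (BinaryTree.node a S₁ S₂).numNodes ≤
          r * (BinaryTree.node a T₁ T₂).numNodes := by
        simp only [BinaryTree.numNodes]
        nlinarith [Nat.mul_le_mul_left h hcard]
      by_cases hsmall : (BinaryTree.node a S₁ S₂).numNodes ≤ h
      · exact ⟨.node a S₁ S₂, X₁ ∪ X₂, hsmall, hf₁.union hf₂, hcov, hbound⟩
      -- The joined residual tree has between `h + 1` and `2 * h + 1` nodes and is cut off whole: it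
      -- adds at most `r` elements to `X`, paid for by its more than `h` nodes at weight `r` each.
      · refine ⟨.nil, ↑(G.found O (.node a S₁ S₂) (some v)) ∪ (X₁ ∪ X₂),
          by simp [BinaryTree.numNodes], (Finset.finite_toSet _).union (hf₁.union hf₂),
          hcov.trans Set.subset_union_right, ?_⟩
        have hle := hO v hv (.node a S₁ S₂) (by simp only [BinaryTree.numNodes]; omega)
        have hc := Set.ncard_union_le (↑(G.found O (.node a S₁ S₂) (some v)) : Set α) (X₁ ∪ X₂)
        rw [Set.ncard_coe_finset] at hc
        have e₁ := Nat.mul_le_mul_left h (hc.trans (Nat.add_le_add_right hle _))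
        have e₂ := Nat.mul_le_mul_left r (not_le.mp hsmall).le
        simp only [BinaryTree.numNodes] at *
        nlinarith

/-- If every tree of at most `2 * h + 1` nodes finds at most `r` elements of `O`, then a tree of
`N` nodes finds at most `r * N / h + r` elements of `O`. -/
lemma mul_card_found_le {O : Finset α} {r h : ℕ}
    (hO : ∀ z ∈ G.cells, ∀ T : BinaryTree Unit, T.numNodes ≤ 2 * h + 1 →
      (G.found O T (some z)).card ≤ r)
    (T : BinaryTree Unit) (z : ℕ) (hz : z ∈ G.cells) :
    h * (G.found O T (some z)).card ≤ r * (T.numNodes + h) := by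
  obtain ⟨T', X, hT', hX, hcov, hn⟩ :=
    exists_residual_tree hO T (some z) (by rintro _ ⟨⟩; exact hz)
  have h1 := Set.ncard_le_ncard hcov ((Finset.finite_toSet _).union hX)
  have h2 := Set.ncard_union_le (↑(G.found O T' (some z)) : Set α) X
  rw [Set.ncard_coe_finset] at h1 h2
  have h3 := hO z hz T' (by omega)
  have h4 : (G.found O T (some z)).card ≤ r + X.ncard := by omega
  nlinarith [Nat.mul_le_mul_left h h4]

open scoped Classical in
/-- The trees of at most `a` nodes, hanging at a cell of `G`, that find more than `r` elements
of `O`. -/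
noncomputable def richTrees (G : PointerStructure α) (O : Finset α) (r a : ℕ) :
    Finset (ℕ × BinaryTree Unit) :=
  (G.cells ×ˢ treesOfNumNodesLE a).filter fun f => r < (G.found O f.2 (some f.1)).card

lemma mem_richTrees {O : Finset α} {r a : ℕ} {f : ℕ × BinaryTree Unit} :
    f ∈ G.richTrees O r a ↔
      (f.1 ∈ G.cells ∧ f.2.numNodes ≤ a) ∧ r < (G.found O f.2 (some f.1)).card := by
  classical simp [richTrees]

/-- A set `O` of elements found by a tree of at most `H * |O|` nodes is rich in small trees. -/
theorem card_le_mul_card_richTrees {O : Finset α} {r H : ℕ} {T : BinaryTree Unit}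
    (hr : 0 < r) (hH : 0 < H) (hO : ↑O ⊆ G.elems T (some G.root))
    (hT : T.numNodes ≤ H * O.card) (hk : 4 * r ≤ O.card) :
    O.card ≤ 2 * (8 * r * H + 1) * (G.richTrees O r (8 * r * H + 1)).card := by
  classical
  -- This is `2 * h + 1` for `h = 4 * r * H`, the scale at which `mul_card_found_le` is used below.
  set a := 8 * r * H + 1 with ha
  by_contra! hlt
  set U := (G.richTrees O r a).biUnion fun f => G.found O f.2 (some f.1) with hU
  have hUcard : U.card ≤ a * (G.richTrees O r a).card := by
    rw [mul_comm]
    exact Finset.card_biUnion_le_card_mul _ _ _ fun f hf =>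
      (card_found_le _ _ _).trans (mem_richTrees.mp hf).1.2
  have hdiff : O.card ≤ (O \ U).card + U.card := by
    rw [Nat.add_comm, ← Nat.sub_le_iff_le_add']
    exact Finset.le_card_sdiff U O
  have hpoor : ∀ z ∈ G.cells, ∀ T : BinaryTree Unit, T.numNodes ≤ 2 * (4 * r * H) + 1 →
      (G.found (O \ U) T (some z)).card ≤ r := by
    intro z hz T' hT'
    by_contra! hrich
    have hsub : G.found (O \ U) T' (some z) ⊆ G.found O T' (some z) := by
      intro p
      simp only [mem_found, Finset.mem_sdiff]
      tauto
    have hmem : (z, T') ∈ G.richTrees O r a :=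
      mem_richTrees.mpr ⟨⟨hz, hT'.trans_eq (by rw [ha]; ring)⟩,
        hrich.trans_le (Finset.card_le_card hsub)⟩
    obtain ⟨p, hp⟩ := Finset.card_pos.mp (Nat.zero_lt_of_lt hrich)
    have hpU : p ∈ U := Finset.mem_biUnion.mpr ⟨_, hmem, hsub hp⟩
    exact (Finset.mem_sdiff.mp (mem_found.mp hp).1).2 hpU
  have hall : G.found (O \ U) T (some G.root) = O \ U := by
    ext p
    simp only [mem_found, Finset.mem_sdiff]
    exact ⟨fun h => h.1, fun h => ⟨h, hO h.1⟩⟩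
  have hkey := mul_card_found_le hpoor T G.root G.root_mem
  rw [hall] at hkey
  -- The rich trees cover less than half of `O`, and no small tree is rich for the rest. Doubling
  -- `hkey` gives `4rH|O| < 2rH|O| + 8r²H`, that is `|O| < 4r`.
  have hhalf : O.card < 2 * (O \ U).card := by nlinarith
  have h1 : 4 * r * H * O.card < 2 * (r * (T.numNodes + 4 * r * H)) := by
    have : 0 < 4 * r * H := by positivity
    nlinarith
  have h2 : r * T.numNodes ≤ r * (H * O.card) := Nat.mul_le_mul_left r hT
  have h3 : r * H * (4 * r) ≤ r * H * O.card := Nat.mul_le_mul_left _ hk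
  nlinarith

end PointerStructure

end RangeReporting

/-! ### Double counting: coinciding values, rich trees, and numbers of outputs. -/

namespace RangeReporting

/-- If a map takes few values on `I`, then it takes equal values on many pairs. -/
lemma card_le_card_image_add_pairs {ι β : Type*} [DecidableEq ι] [DecidableEq β] (I : Finset ι)
    (f : ι → β) {lam : ℝ} (hlam : 0 < lam) :
    (I.card : ℝ) ≤ (I.image f).card * (1 + lam) +
      (I.offDiag.filter fun p => f p.1 = f p.2).card / lam := by
  have hpairs : (I.offDiag.filter fun p => f p.1 = f p.2).card =
      ∑ b ∈ I.image f, ((I.filter fun i => f i = b).card * (I.filter fun i => f i = b).card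
        - (I.filter fun i => f i = b).card) := by
    rw [Finset.card_eq_sum_card_fiberwise (f := fun p => f p.1) (t := I.image f)]
    · refine Finset.sum_congr rfl fun b _ => ?_
      rw [← Finset.offDiag_card]
      congr 1
      ext ⟨i, j⟩
      simp only [Finset.mem_filter, Finset.mem_offDiag]
      constructor
      · rintro ⟨⟨⟨hi, hj, hne⟩, he⟩, hb⟩
        exact ⟨⟨hi, hb⟩, ⟨hj, he ▸ hb⟩, hne⟩
      · rintro ⟨⟨hi, hb⟩, ⟨hj, hb'⟩, hne⟩
        exact ⟨⟨⟨hi, hj, hne⟩, hb.trans hb'.symm⟩, hb⟩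
    · intro p hp
      simp only [Finset.coe_filter, Finset.mem_offDiag, Set.mem_ofPred_eq] at hp
      exact Finset.mem_image_of_mem f hp.1.1
  rw [hpairs, Finset.card_eq_sum_card_image f I]
  push_cast
  rw [Finset.sum_div, ← nsmul_eq_mul, ← Finset.sum_const, ← Finset.sum_add_distrib]
  refine Finset.sum_le_sum fun b _ => ?_
  set n := (I.filter fun i => f i = b).card
  rw [Nat.cast_sub (Nat.le_mul_self n)]
  push_cast
  -- A fibre of size `n` has `n * (n - 1)` ordered pairs; once `n - 1 > lam`, these alone account
  -- for all of its elements.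
  rcases le_or_gt (n : ℝ) (1 + lam) with h | h
  · have : (0 : ℝ) ≤ ((n : ℝ) * n - n) / lam := by
      refine div_nonneg ?_ hlam.le
      have := Nat.le_mul_self n
      have : (n : ℝ) ≤ n * n := by exact_mod_cast this
      linarith
    linarith
  · have : (n : ℝ) ≤ ((n : ℝ) * n - n) / lam := by
      rw [le_div_iff₀ hlam]
      nlinarith
    linarith

namespace PointerStructure

variable {α : Type*} {G : PointerStructure α}

lemma card_toFinset_elems_le (T : BinaryTree Unit) (x : Option ℕ) :
    (G.finite_elems T x).toFinset.card ≤ T.numNodes := by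
  convert G.card_found_le (G.finite_elems T x).toFinset T x using 2
  ext p
  simp

/-- If any two of the sets `O i` share at most `r` elements, and each `O i` is found by a tree of
`O(|O i|)` nodes, then the total size of the `O i` is at most the space times `2 ^ O(r)`. -/
theorem sum_card_le_mul_space {ι : Type*} (I : Finset ι) (O : ι → Finset α) {r H : ℕ}
    (hr : 0 < r) (hH : 0 < H)
    (hO : ∀ i ∈ I, ∃ T : BinaryTree Unit, T.numNodes ≤ H * (O i).card ∧
      ↑(O i) ⊆ G.elems T (some G.root))
    (hk : ∀ i ∈ I, 4 * r ≤ (O i).card)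
    (hshare : ∀ i ∈ I, ∀ j ∈ I, i ≠ j → ∀ W : Finset α, W ⊆ O i → W ⊆ O j → W.card ≤ r) :
    ∑ i ∈ I, (O i).card ≤ 2 * (8 * r * H + 1) *
      (G.space * 4 ^ (8 * r * H + 1 + 1) * 2 ^ (8 * r * H + 1)) := by
  classical
  set a := 8 * r * H + 1
  have h1 : ∀ i ∈ I, (O i).card ≤ 2 * a * (G.richTrees (O i) r a).card := by
    intro i hi
    obtain ⟨T, hT, hOT⟩ := hO i hi
    exact card_le_mul_card_richTrees hr hH hOT hT (hk i hi)
  refine (Finset.sum_le_sum h1).trans ?_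
  rw [← Finset.mul_sum]
  refine Nat.mul_le_mul_left _ ?_
  -- A tree has at most `2 ^ a` subsets of found elements, and two outputs for which it is rich
  -- cannot give the same subset, since they would share more than `r` elements.
  have h2 : ∀ f ∈ G.cells ×ˢ treesOfNumNodesLE a,
      (I.filter fun i => r < (G.found (O i) f.2 (some f.1)).card).card ≤ 2 ^ a := by
    intro f hf
    have hfa : f.2.numNodes ≤ a := mem_treesOfNumNodesLE.mp (Finset.mem_product.mp hf).2
    calc _ ≤ (G.finite_elems f.2 (some f.1)).toFinset.powerset.card := by
          refine Finset.card_le_card_of_injOn (fun i => G.found (O i) f.2 (some f.1)) ?_ ?_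
          · intro i _
            simp only [Finset.mem_coe, Finset.mem_powerset]
            intro p hp
            simpa using (mem_found.mp hp).2
          · intro i hi j hj hij
            by_contra hne
            simp only [Finset.coe_filter, Set.mem_ofPred_eq] at hi hj
            refine absurd (hshare i hi.1 j hj.1 hne (G.found (O i) f.2 (some f.1)) ?_ ?_)
              (not_le.mpr hi.2)
            · exact fun p hp => (mem_found.mp hp).1
            · intro p hp
              simp only at hij
              rw [hij] at hp
              exact (mem_found.mp hp).1
      _ ≤ 2 ^ a := by
          rw [Finset.card_powerset]
          exact Nat.pow_le_pow_right (by norm_num) ((card_toFinset_elems_le _ _).trans hfa)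
  calc ∑ i ∈ I, (G.richTrees (O i) r a).card
      = ∑ f ∈ G.cells ×ˢ treesOfNumNodesLE a,
          (I.filter fun i => r < (G.found (O i) f.2 (some f.1)).card).card := by
        simp only [richTrees, Finset.card_filter]
        exact Finset.sum_comm
    _ ≤ (G.cells ×ˢ treesOfNumNodesLE a).card * 2 ^ a := Finset.sum_le_card_nsmul _ _ _ h2
    _ ≤ G.space * 4 ^ (a + 1) * 2 ^ a := by
        rw [Finset.card_product]
        exact Nat.mul_le_mul_right _ (Nat.mul_le_mul_left _ (card_treesOfNumNodesLE a))

/-- Executions of time `N` have at most `2 ^ O(N)` different outputs. -/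
theorem card_le_of_forall_subset_elems (F : Finset (Finset α)) (N : ℕ)
    (hF : ∀ O ∈ F, ∃ T : BinaryTree Unit, T.numNodes ≤ N ∧ ↑O ⊆ G.elems T (some G.root)) :
    F.card ≤ 4 ^ (N + 1) * 2 ^ N := by
  classical
  have hsub : F ⊆ (treesOfNumNodesLE N).biUnion fun T =>
      (G.finite_elems T (some G.root)).toFinset.powerset := by
    intro O hO
    obtain ⟨T, hT, hs⟩ := hF O hO
    refine Finset.mem_biUnion.mpr ⟨T, mem_treesOfNumNodesLE.mpr hT, ?_⟩
    rw [Finset.mem_powerset]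
    intro p hp
    simpa using hs hp
  refine (Finset.card_le_card hsub).trans ((Finset.card_biUnion_le_card_mul _ _ (2 ^ N) ?_).trans
    (Nat.mul_le_mul_right _ (card_treesOfNumNodesLE N)))
  intro T hT
  rw [Finset.card_powerset]
  exact Nat.pow_le_pow_right (by norm_num)
    ((card_toFinset_elems_le _ _).trans (mem_treesOfNumNodesLE.mp hT))

end PointerStructure

end RangeReporting

/-! ### Choice of the points by derandomized exponential moments. -/

namespace RangeReporting

/-- The method of conditional expectations: there are `n` distinct points that do at least as well
as `n` independent random points. -/
lemma exists_finset_sum_prod_le {E J : Type*} [MeasurableSpace E] [Fintype J] (ν : Measure E)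
    [IsProbabilityMeasure ν] [NullSingletonClass ν] {K : Set E} (hK : ν Kᶜ = 0) (f : J → E → ℝ)
    (hf : ∀ j, Integrable (f j) ν) (n : ℕ) (w : J → ℝ) :
    ∃ P : Finset E, P.card = n ∧ ↑P ⊆ K ∧
      ∑ j, w j * ∏ x ∈ P, f j x ≤ ∑ j, w j * (∫ x, f j x ∂ν) ^ n := by
  classical
  induction n generalizing w with
  | zero => exact ⟨∅, by simp⟩
  | succ n ih =>
    -- The expected factor of the last point is absorbed into the weights, and that point is fixed
    -- afterwards. Avoiding the null set `Kᶜ ∪ P` keeps it in `K` and distinct from the others.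
    obtain ⟨P, hcard, hPK, hP⟩ := ih fun j => w j * ∫ x, f j x ∂ν
    have hnull : ν (Kᶜ ∪ ↑P) = 0 :=
      measure_union_null hK (P.finite_toSet.measure_zero ν)
    have hint : Integrable (fun x => ∑ j, (w j * ∏ y ∈ P, f j y) * f j x) ν :=
      integrable_finsetSum _ fun j _ => (hf j).const_mul _
    obtain ⟨x, hx, hle⟩ := exists_notMem_null_le_integral hint hnull
    simp only [Set.mem_union, Set.mem_compl_iff, not_or, not_not, Finset.mem_coe] at hx
    refine ⟨insert x P, by rw [Finset.card_insert_of_notMem hx.2, hcard], ?_, ?_⟩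
    · rw [Finset.coe_insert]
      exact Set.insert_subset hx.1 hPK
    · rw [integral_finsetSum _ fun j _ => (hf j).const_mul _] at hle
      simp only [integral_const_mul] at hle
      calc ∑ j, w j * ∏ y ∈ insert x P, f j y = ∑ j, (w j * ∏ y ∈ P, f j y) * f j x := by
            refine Finset.sum_congr rfl fun j _ => ?_
            rw [Finset.prod_insert hx.2]
            ring
        _ ≤ ∑ j, (w j * ∏ y ∈ P, f j y) * ∫ x, f j x ∂ν := hle
        _ = ∑ j, (w j * ∫ x, f j x ∂ν) * ∏ y ∈ P, f j y :=
            Finset.sum_congr rfl fun j _ => by ring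
        _ ≤ ∑ j, (w j * ∫ x, f j x ∂ν) * (∫ x, f j x ∂ν) ^ n := hP
        _ = ∑ j, w j * (∫ x, f j x ∂ν) ^ (n + 1) :=
            Finset.sum_congr rfl fun j _ => by ring

/-- The function that is `z` on `A` and `1` elsewhere; its product over `P` is the generating
function of the number of points of `P` in `A`. -/
noncomputable def genFun {E : Type*} (A : Set E) (z : ℝ) (x : E) : ℝ :=
  1 + A.indicator (fun _ => z - 1) x

lemma prod_genFun {E : Type*} (A : Set E) (z : ℝ) (P : Finset E) :
    ∏ x ∈ P, genFun A z x = z ^ ((↑P : Set E) ∩ A).ncard := by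
  classical
  have h1 : ∀ x, genFun A z x = if x ∈ A then z else 1 := by
    intro x
    by_cases hx : x ∈ A <;> simp [genFun, hx]
  have h2 : (↑P : Set E) ∩ A = ↑(P.filter (· ∈ A)) := by
    ext x; simp
  rw [h2, Set.ncard_coe_finset]
  simp only [h1]
  rw [Finset.prod_ite]
  simp

section

variable {E : Type*} [MeasurableSpace E] {ν : Measure E} [IsProbabilityMeasure ν] {A : Set E}

lemma integrable_genFun (hA : NullMeasurableSet A ν) (z : ℝ) : Integrable (genFun A z) ν :=
  (integrable_const _).add ((integrable_const (z - 1)).indicator₀ hA)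

lemma integral_genFun (hA : NullMeasurableSet A ν) (z : ℝ) :
    ∫ x, genFun A z x ∂ν = 1 + (z - 1) * ν.real A := by
  unfold genFun
  rw [integral_add (integrable_const _) ((integrable_const (z - 1)).indicator₀ hA),
    integral_indicator₀ hA]
  simp [mul_comm]

/-- The inequality `1 + x ≤ exp x` for one point, raised to the power `n`; `z ≥ 0` makes the base
nonnegative. -/
lemma integral_genFun_pow_le (hA : NullMeasurableSet A ν) {z : ℝ} (hz : 0 ≤ z) (n : ℕ) :
    (∫ x, genFun A z x ∂ν) ^ n ≤ Real.exp (n * ((z - 1) * ν.real A)) := by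
  rw [integral_genFun hA, Real.exp_nat_mul]
  have h1 : ν.real A ≤ 1 := measureReal_le_one
  have h0 : 0 ≤ ν.real A := measureReal_nonneg
  refine pow_le_pow_left₀ (by nlinarith) ?_ n
  linarith [Real.add_one_le_exp ((z - 1) * ν.real A)]

/-- There are `n` points of `K` such that no large part of the sets `R i` has few points, and no
large part of the pairs shares many points. -/
lemma exists_points [NullSingletonClass ν] {K : Set E} (hK : ν Kᶜ = 0) {m : ℕ} {R : Fin m → Set E}
    (hR : ∀ i, NullMeasurableSet (R i) ν) {p q : ℝ} (hp : ∀ i, p ≤ ν.real (R i))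
    (hq : ∀ i j, i ≠ j → ν.real (R i ∩ R j) ≤ q) {z : ℝ} (hz : 1 ≤ z) {w₁ w₂ : ℝ} (h₁ : 0 ≤ w₁)
    (h₂ : 0 ≤ w₂) (n : ℕ) :
    ∃ P : Finset E, P.card = n ∧ ↑P ⊆ K ∧
      w₁ * ∑ i, (1 / 2 : ℝ) ^ ((↑P : Set E) ∩ R i).ncard +
        w₂ * ∑ x ∈ (Finset.univ : Finset (Fin m)).offDiag,
          z ^ ((↑P : Set E) ∩ (R x.1 ∩ R x.2)).ncard ≤
      w₁ * (m * Real.exp (-(n * p / 2))) + w₂ * ((m : ℝ) ^ 2 * Real.exp (n * (z * q))) := by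
  classical
  let J := Fin m ⊕ (Finset.univ : Finset (Fin m)).offDiag
  let A : J → Set E := Sum.elim R fun x => R x.1.1 ∩ R x.1.2
  let ζ : J → ℝ := Sum.elim (fun _ => 1 / 2) fun _ => z
  let w : J → ℝ := Sum.elim (fun _ => w₁) fun _ => w₂
  have hA : ∀ j, NullMeasurableSet (A j) ν := by
    rintro (i | x)
    · exact hR i
    · exact (hR _).inter (hR _)
  obtain ⟨P, hcard, hPK, hP⟩ := exists_finset_sum_prod_le ν hK (fun j => genFun (A j) (ζ j))
    (fun j => integrable_genFun (hA j) _) n w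
  refine ⟨P, hcard, hPK, ?_⟩
  simp only [prod_genFun] at hP
  rw [Fintype.sum_sum_type, Fintype.sum_sum_type] at hP
  simp only [A, ζ, w, Sum.elim_inl, Sum.elim_inr] at hP
  rw [← Finset.mul_sum, ← Finset.mul_sum, ← Finset.mul_sum, ← Finset.mul_sum,
    Finset.sum_coe_sort (Finset.univ : Finset (Fin m)).offDiag
      (fun x => z ^ ((↑P : Set E) ∩ (R x.1 ∩ R x.2)).ncard),
    Finset.sum_coe_sort (Finset.univ : Finset (Fin m)).offDiag
      (fun x => (∫ y, genFun (R x.1 ∩ R x.2) z y ∂ν) ^ n)] at hP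
  refine hP.trans (add_le_add (mul_le_mul_of_nonneg_left ?_ h₁)
    (mul_le_mul_of_nonneg_left ?_ h₂))
  · calc _ ≤ ∑ _i : Fin m, Real.exp (-(n * p / 2)) := by
          refine Finset.sum_le_sum fun i _ => ?_
          refine (integral_genFun_pow_le (hR i) (by norm_num) n).trans ?_
          rw [Real.exp_le_exp]
          have := mul_le_mul_of_nonneg_left (hp i) (Nat.cast_nonneg (α := ℝ) n)
          linarith
      _ = _ := by simp
  · calc _ ≤ ∑ _x ∈ (Finset.univ : Finset (Fin m)).offDiag, Real.exp (n * (z * q)) := by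
          refine Finset.sum_le_sum fun x hx => ?_
          refine (integral_genFun_pow_le ((hR _).inter (hR _)) (by linarith) n).trans ?_
          rw [Real.exp_le_exp]
          refine mul_le_mul_of_nonneg_left ?_ (Nat.cast_nonneg _)
          have h := hq x.1 x.2 (Finset.mem_offDiag.mp hx).2.2
          have h0 : 0 ≤ ν.real (R x.1 ∩ R x.2) := measureReal_nonneg
          nlinarith
      _ ≤ _ := by
          rw [Finset.sum_const, nsmul_eq_mul]
          refine mul_le_mul_of_nonneg_right ?_ (Real.exp_pos _).le
          rw [Finset.offDiag_card]
          have : (Finset.univ : Finset (Fin m)).card * (Finset.univ : Finset (Fin m)).card -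
            (Finset.univ : Finset (Fin m)).card ≤ m ^ 2 := by
              simp [sq]
          exact_mod_cast this

end

section

variable {D : ℕ} {K : Set (EuclideanSpace ℝ (Fin D))} {l : ℝ}

/-- Translation and change of orthonormal basis preserve volume, which reduces measurability and
volume to an axis-parallel box. -/
lemma IsHypercube.exists_preimage (hK : IsHypercube K l) :
    ∃ g : EuclideanSpace ℝ (Fin D) → (Fin D → ℝ), MeasurePreserving g ∧
      K = g ⁻¹' Set.pi Set.univ fun _ => Set.Icc 0 l := by
  obtain ⟨a, b, rfl⟩ := hK
  refine ⟨fun x => WithLp.ofLp (b.repr (x - a)), ?_, ?_⟩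
  · exact (PiLp.volume_preserving_ofLp (Fin D)).comp
      (b.measurePreserving_repr.comp (measurePreserving_sub_right volume a))
  · ext x
    simp [Set.pi, -Set.pi_univ_Icc]

lemma IsHypercube.measurableSet (hK : IsHypercube K l) : MeasurableSet K := by
  obtain ⟨g, hg, rfl⟩ := hK.exists_preimage
  exact hg.measurable (MeasurableSet.univ_pi fun _ => measurableSet_Icc)

lemma IsHypercube.volume_eq (hK : IsHypercube K l) (hl : 0 < l) :
    volume K = ENNReal.ofReal (l ^ D) := by
  obtain ⟨g, hg, rfl⟩ := hK.exists_preimage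
  rw [hg.measure_preimage (MeasurableSet.univ_pi fun _ => measurableSet_Icc).nullMeasurableSet,
    volume_pi_pi]
  simp [Real.volume_Icc, ENNReal.ofReal_pow hl.le]

/-- There are `n` points of the hypercube such that most of the ranges have their fair share of
points, and few pairs of ranges share many points. -/
lemma IsHypercube.exists_points (hK : IsHypercube K l) (hl : 0 < l) (hD : 1 ≤ D) {m : ℕ}
    {R : Fin m → Set (EuclideanSpace ℝ (Fin D))} (hR : ∀ i, NullMeasurableSet (R i) volume)
    {p q : ℝ} (hp : ∀ i, p * l ^ D ≤ volume.real (R i ∩ K))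
    (hq : ∀ i j, i ≠ j → volume.real (R i ∩ R j ∩ K) ≤ q * l ^ D) {z : ℝ} (hz : 1 ≤ z)
    {w₁ w₂ : ℝ} (h₁ : 0 ≤ w₁) (h₂ : 0 ≤ w₂) (n : ℕ) :
    ∃ P : Finset (EuclideanSpace ℝ (Fin D)), P.card = n ∧ ↑P ⊆ K ∧
      w₁ * ∑ i, (1 / 2 : ℝ) ^ ((↑P : Set (EuclideanSpace ℝ (Fin D))) ∩ R i).ncard +
        w₂ * ∑ x ∈ (Finset.univ : Finset (Fin m)).offDiag,
          z ^ ((↑P : Set (EuclideanSpace ℝ (Fin D))) ∩ (R x.1 ∩ R x.2)).ncard ≤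
      w₁ * (m * Real.exp (-(n * p / 2))) + w₂ * ((m : ℝ) ^ 2 * Real.exp (n * (z * q))) := by
  have hlD : 0 < l ^ D := pow_pos hl D
  have hvol := hK.volume_eq hl
  have hne : volume K ≠ 0 := by
    rw [hvol]; simpa using hlD
  have htop : volume K ≠ ⊤ := by rw [hvol]; exact ENNReal.ofReal_ne_top
  -- Positive dimension makes singletons Lebesgue null.
  have : Nonempty (Fin D) := ⟨⟨0, hD⟩⟩
  have : IsProbabilityMeasure (ProbabilityTheory.cond volume K) :=
    ProbabilityTheory.cond_isProbabilityMeasure_of_finite hne htop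
  have hac : ProbabilityTheory.cond volume K ≪ volume :=
    ProbabilityTheory.cond_absolutelyContinuous
  have : NullSingletonClass (ProbabilityTheory.cond volume K) := ⟨fun x => hac (measure_singleton x)⟩
  have hreal : ∀ A, (ProbabilityTheory.cond volume K).real A = volume.real (A ∩ K) / l ^ D := by
    intro A
    rw [measureReal_def, ProbabilityTheory.cond_apply hK.measurableSet, ENNReal.toReal_mul,
      ENNReal.toReal_inv, hvol, ENNReal.toReal_ofReal hlD.le, Set.inter_comm, measureReal_def]
    field_simp
  refine RangeReporting.exists_points (ν := ProbabilityTheory.cond volume K) ?_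
    (fun i => (hR i).mono_ac hac) ?_ ?_ hz h₁ h₂ n
  · rw [ProbabilityTheory.cond_apply hK.measurableSet]
    simp
  · intro i
    rw [hreal, le_div_iff₀ hlD]
    exact hp i
  · intro i j hij
    rw [hreal, div_le_iff₀ hlD]
    exact hq i j hij

end

end RangeReporting

namespace RangeReporting

/-! ### Discarding small outputs and the space bound for the remaining ones. -/

namespace PointerStructure

variable {α : Type*} {G : PointerStructure α} [DecidableEq α]

/-- If few pairs of outputs share many elements, then there are few outputs of a given small
size. -/
lemma card_le_of_sum_pow_inter_le {m : ℕ} (hm : 0 < m) {O : Fin m → Finset α} {I : Finset (Fin m)}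
    {H k : ℕ} (hk : 1 ≤ k) (hI : ∀ i ∈ I, (O i).card = k)
    (htree : ∀ i ∈ I, ∃ T : BinaryTree Unit, T.numNodes ≤ H * (O i).card ∧
      ↑(O i) ⊆ G.elems T (some G.root))
    {M y : ℝ} (hM : 0 ≤ M) (hy : 0 < y) (hyH : (8 : ℝ) ^ H ≤ y)
    (hpairs : ∑ x ∈ (Finset.univ : Finset (Fin m)).offDiag, (y ^ 2) ^ (O x.1 ∩ O x.2).card ≤
      M * (m : ℝ) ^ 2) :
    (I.card : ℝ) ≤ 4 * 8 ^ (H * k) + m * ((4 * 8 ^ H + M) / y) := by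
  have hm' : (0 : ℝ) < m := by exact_mod_cast hm
  have hyk : 0 < y ^ k := pow_pos hy k
  have h1y : 1 ≤ y := le_trans (one_le_pow₀ (by norm_num)) hyH
  -- This `lam` balances the two terms. A coinciding pair weighs `y ^ (2 * k)`: one factor `y ^ k`
  -- cancels the one in `lam`, and the other is gained in the bound `M * m / y ^ k`.
  have h := card_le_card_image_add_pairs I O (lam := m / y ^ k) (by positivity)
  have himage : ((I.image O).card : ℝ) ≤ 4 * 8 ^ (H * k) := by
    have := G.card_le_of_forall_subset_elems (I.image O) (H * k) (by
      intro S hS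
      obtain ⟨i, hi, rfl⟩ := Finset.mem_image.mp hS
      simpa only [hI i hi] using htree i hi)
    calc ((I.image O).card : ℝ) ≤ 4 ^ (H * k + 1) * 2 ^ (H * k) := by exact_mod_cast this
      _ = 4 * 8 ^ (H * k) := by
        rw [pow_succ, show (8 : ℝ) = 4 * 2 by norm_num, mul_pow]; ring
  have hsame : ((I.offDiag.filter fun p => O p.1 = O p.2).card : ℝ) * (y ^ 2) ^ k ≤
      M * (m : ℝ) ^ 2 := by
    refine le_trans ?_ hpairs
    rw [← nsmul_eq_mul, ← Finset.sum_const]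
    calc _ ≤ ∑ x ∈ I.offDiag.filter fun p => O p.1 = O p.2, (y ^ 2) ^ (O x.1 ∩ O x.2).card := by
          refine Finset.sum_le_sum fun x hx => ?_
          obtain ⟨hx, he⟩ := Finset.mem_filter.mp hx
          rw [← he, Finset.inter_self, hI _ (Finset.mem_offDiag.mp hx).1]
      _ ≤ _ := by
          refine Finset.sum_le_sum_of_subset_of_nonneg ?_ fun _ _ _ => by positivity
          exact (Finset.filter_subset _ _).trans
            (Finset.offDiag_mono (Finset.subset_univ I))
  have hratio : (8 : ℝ) ^ (H * k) / y ^ k ≤ 8 ^ H / y := by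
    rw [pow_mul, ← div_pow]
    exact pow_le_of_le_one (by positivity) ((div_le_one hy).mpr hyH) (by omega)
  have hy1 : y ≤ y ^ k := le_self_pow₀ h1y (by omega)
  have hlast : ((I.offDiag.filter fun p => O p.1 = O p.2).card : ℝ) / (m / y ^ k) ≤
      m * (M / y) := by
    rw [div_div_eq_mul_div, div_le_iff₀ hm']
    have e : ((I.offDiag.filter fun p => O p.1 = O p.2).card : ℝ) * y ^ k ≤
        M * (m : ℝ) ^ 2 / y ^ k := by
      rw [le_div_iff₀ hyk]
      calc _ = ((I.offDiag.filter fun p => O p.1 = O p.2).card : ℝ) * (y ^ 2) ^ k := by ring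
        _ ≤ _ := hsame
    refine e.trans ?_
    calc M * (m : ℝ) ^ 2 / y ^ k ≤ M * (m : ℝ) ^ 2 / y := by gcongr
      _ = m * (M / y) * m := by ring
  calc (I.card : ℝ) ≤ _ := h
    _ ≤ 4 * 8 ^ (H * k) * (1 + m / y ^ k) + m * (M / y) := by gcongr
    _ = 4 * 8 ^ (H * k) + m * (4 * (8 ^ (H * k) / y ^ k) + M / y) := by ring
    _ ≤ 4 * 8 ^ (H * k) + m * (4 * (8 ^ H / y) + M / y) := by gcongr
    _ = _ := by ring

/-- If few pairs of outputs share many elements, then there are few small outputs. -/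
lemma card_filter_lt_le {m : ℕ} (hm : 0 < m) {O : Fin m → Finset α} {I : Finset (Fin m)}
    {H s : ℕ} (hI : ∀ i ∈ I, 1 ≤ (O i).card)
    (htree : ∀ i ∈ I, ∃ T : BinaryTree Unit, T.numNodes ≤ H * (O i).card ∧
      ↑(O i) ⊆ G.elems T (some G.root))
    {M y : ℝ} (hM : 0 ≤ M) (hy : 0 < y) (hyH : (8 : ℝ) ^ H ≤ y)
    (hpairs : ∑ x ∈ (Finset.univ : Finset (Fin m)).offDiag, (y ^ 2) ^ (O x.1 ∩ O x.2).card ≤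
      M * (m : ℝ) ^ 2) :
    ((I.filter fun i => (O i).card < s).card : ℝ) ≤
      s * (4 * 8 ^ (H * s) + m * ((4 * 8 ^ H + M) / y)) := by
  rw [Finset.card_eq_sum_card_fiberwise (f := fun i => (O i).card) (t := Finset.range s)
    (fun i hi => by simpa using (Finset.mem_filter.mp hi).2)]
  push_cast
  refine (Finset.sum_le_card_nsmul _ _ (4 * 8 ^ (H * s) + m * ((4 * 8 ^ H + M) / y)) ?_).trans
    (by rw [Finset.card_range, nsmul_eq_mul])
  intro k hk
  have hks : k < s := Finset.mem_range.mp hk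
  rcases Nat.eq_zero_or_pos k with rfl | hk0
  · rw [Finset.card_eq_zero.mpr]
    · simp only [Nat.cast_zero]; positivity
    · refine Finset.filter_eq_empty_iff.mpr fun i hi => ?_
      have := hI i (Finset.mem_filter.mp hi).1
      omega
  · refine (card_le_of_sum_pow_inter_le (G := G) (H := H) hm hk0 (fun i hi => ?_)
      (fun i hi => ?_) hM hy hyH hpairs).trans ?_
    · exact (Finset.mem_filter.mp hi).2
    · exact htree i (Finset.mem_filter.mp (Finset.mem_filter.mp hi).1).1
    · gcongr
      norm_num

/-- The space lower bound for outputs of which few pairs share many elements. -/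
theorem mul_le_mul_space {m : ℕ} (hm : 0 < m) {O : Fin m → Finset α} {I : Finset (Fin m)}
    {H r : ℕ} (hr : 0 < r) (hH : 0 < H) (hI : ∀ i ∈ I, 1 ≤ (O i).card)
    (htree : ∀ i ∈ I, ∃ T : BinaryTree Unit, T.numNodes ≤ H * (O i).card ∧
      ↑(O i) ⊆ G.elems T (some G.root))
    {M y θ q : ℝ} (hM : 0 ≤ M) (hy : 0 < y) (hyH : (8 : ℝ) ^ H ≤ y)
    (hpairs : ∑ x ∈ (Finset.univ : Finset (Fin m)).offDiag, (y ^ 2) ^ (O x.1 ∩ O x.2).card ≤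
      M * (m : ℝ) ^ 2)
    (hshare : M * (m : ℝ) ^ 2 < (y ^ 2) ^ r)
    (hmany : θ * m ≤ I.card)
    (hsmall : ((4 * r : ℕ) : ℝ) * (4 * 8 ^ (H * (4 * r)) + m * ((4 * 8 ^ H + M) / y)) ≤
      θ / 2 * m)
    (hq : 0 ≤ q) (hqI : ∀ i ∈ I, q ≤ (O i).card) :
    θ / 2 * m * q ≤ 8 * 16 ^ (8 * r * H + 1) * G.space := by
  set a := 8 * r * H + 1
  have h1y : 1 ≤ y := le_trans (one_le_pow₀ (by norm_num)) hyH
  have hsm := card_filter_lt_le (G := G) (s := 4 * r) hm hI htree hM hy hyH hpairs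
  set Ib := I.filter fun i => ¬ (O i).card < 4 * r with hIb
  have hcard : I.card = (I.filter fun i => (O i).card < 4 * r).card + Ib.card :=
    (Finset.card_filter_add_card_filter_not _).symm
  have hbig : θ / 2 * m ≤ Ib.card := by
    have : (I.card : ℝ) = (I.filter fun i => (O i).card < 4 * r).card + Ib.card := by
      exact_mod_cast hcard
    linarith
  -- A single pair sharing more than `r` elements would already exceed the bound on the whole pair
  -- sum.
  have hinter : ∀ i j, i ≠ j → (O i ∩ O j).card ≤ r := by
    intro i j hij
    by_contra! hlt
    have h1 : (y ^ 2) ^ (O i ∩ O j).card ≤ M * (m : ℝ) ^ 2 :=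
      (Finset.single_le_sum
        (f := fun x : Fin m × Fin m => (y ^ 2) ^ (O x.1 ∩ O x.2).card)
        (fun _ _ => by positivity) (a := (i, j))
        (by simpa [Finset.mem_offDiag] using hij)).trans hpairs
    have h2 : (y ^ 2) ^ r ≤ (y ^ 2) ^ (O i ∩ O j).card :=
      pow_le_pow_right₀ (one_le_pow₀ h1y) hlt.le
    linarith
  have hmain := G.sum_card_le_mul_space Ib O hr hH
    (fun i hi => htree i (Finset.mem_filter.mp hi).1)
    (fun i hi => not_lt.mp (Finset.mem_filter.mp hi).2)
    (fun i _ j _ hij W hWi hWj =>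
      (Finset.card_le_card (Finset.subset_inter hWi hWj)).trans (hinter i j hij))
  have hsum : (Ib.card : ℝ) * q ≤ ∑ i ∈ Ib, ((O i).card : ℝ) := by
    rw [← nsmul_eq_mul]
    exact Finset.card_nsmul_le_sum _ _ _ fun i hi => hqI i (Finset.mem_filter.mp hi).1
  have hmain' : ∑ i ∈ Ib, ((O i).card : ℝ) ≤ 2 * a * (G.space * 4 ^ (a + 1) * 2 ^ a) := by
    exact_mod_cast hmain
  have ha : (a : ℝ) ≤ 2 ^ a := by exact_mod_cast Nat.lt_two_pow_self.le
  calc θ / 2 * m * q ≤ Ib.card * q := by gcongr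
    _ ≤ 2 * a * (G.space * 4 ^ (a + 1) * 2 ^ a) := hsum.trans hmain'
    _ ≤ 2 * 2 ^ a * (G.space * 4 ^ (a + 1) * 2 ^ a) := by gcongr
    _ = 8 * 16 ^ a * G.space := by
      rw [pow_succ, show (16 : ℝ) = 2 * 4 * 2 by norm_num, mul_pow, mul_pow]; ring

end PointerStructure

end RangeReporting

/-! ### Growth comparisons in terms of `√(log n)`. -/

namespace RangeReporting

section Asymptotics

open Filter Real

lemma tendsto_sqrt_logb_atTop :
    Tendsto (fun n : ℕ => √(logb 2 n)) atTop atTop :=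
  tendsto_sqrt_atTop.comp ((tendsto_logb_atTop one_lt_two).comp tendsto_natCast_atTop_atTop)

lemma rpow_sqrt_logb_sq {n : ℕ} (hn : 1 ≤ n) : (2 : ℝ) ^ (√(logb 2 n) ^ 2) = n := by
  have hn' : (1 : ℝ) ≤ n := by exact_mod_cast hn
  rw [sq_sqrt (logb_nonneg one_lt_two hn'), rpow_logb two_pos (by norm_num) (by linarith)]

lemma le_two_rpow {x : ℝ} (hx : 1 ≤ x) : x ≤ (2 : ℝ) ^ x := by
  have h := one_add_mul_self_le_rpow_one_add (s := 1) (by norm_num) hx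
  norm_num at h
  linarith

lemma eventually_le_two_rpow_mul (a : ℝ) {b : ℝ} (hb : 0 < b) :
    ∀ᶠ x : ℝ in atTop, a ≤ (2 : ℝ) ^ (b * x) := by
  have h : Tendsto (fun x : ℝ => (2 : ℝ) ^ (b * x)) atTop atTop :=
    (tendsto_rpow_atTop_of_base_gt_one 2 one_lt_two).comp (tendsto_id.const_mul_atTop hb)
  exact h.eventually_ge_atTop a

/-- Linear functions are eventually dominated by exponential ones. -/
lemma eventually_mul_le_two_rpow_half (a : ℝ) :
    ∀ᶠ x : ℝ in atTop, a * x ≤ (2 : ℝ) ^ (x / 2) := by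
  filter_upwards [eventually_le_two_rpow_mul (4 * |a|) (b := 1 / 4) (by norm_num),
    eventually_ge_atTop 4] with x h hx
  have h1 := le_two_rpow (x := x / 4) (by linarith)
  calc a * x ≤ 4 * |a| * (x / 4) := by
        nlinarith [le_abs_self a]
    _ ≤ (2 : ℝ) ^ (1 / 4 * x) * (2 : ℝ) ^ (x / 4) := by gcongr
    _ = (2 : ℝ) ^ (x / 2) := by
        rw [← rpow_add two_pos]; ring_nf

/-- At `x = √(log n)` the right side is `n ^ c`, so factors `2 ^ O(√(log n))` are negligible against
`m`. -/
lemma eventually_mul_two_rpow_le (a b : ℝ) {c : ℝ} (hc : 0 < c) :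
    ∀ᶠ x : ℝ in atTop, a * x * (2 : ℝ) ^ (b * x) ≤ (2 : ℝ) ^ (c * x ^ 2) := by
  filter_upwards [eventually_mul_le_two_rpow_half a, eventually_ge_atTop ((b + 1 / 2) / c),
    eventually_ge_atTop 0] with x h hx h0
  calc a * x * (2 : ℝ) ^ (b * x) ≤ (2 : ℝ) ^ (x / 2) * (2 : ℝ) ^ (b * x) := by gcongr
    _ = (2 : ℝ) ^ ((b + 1 / 2) * x) := by rw [← rpow_add two_pos]; ring_nf
    _ ≤ (2 : ℝ) ^ (c * x ^ 2) := by
        refine rpow_le_rpow_of_exponent_le one_le_two ?_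
        rw [div_le_iff₀ hc] at hx
        nlinarith

/-- The conditions on the parameters that hold for all large `n`. -/
lemma eventually_parameters {c M θ : ℝ} (hc : 0 < c) (hM : 0 ≤ M) (hθ : 0 < θ) (H : ℕ) :
    ∀ᶠ n : ℕ in atTop, 1 ≤ √(logb 2 n) ∧ ∀ m : ℕ, |(m : ℝ) - (n : ℝ) ^ c| < 1 →
      0 < m ∧ (8 : ℝ) ^ H ≤ 2 ^ (√(logb 2 n) / 2) ∧
      M * (m : ℝ) ^ 2 <
        (((2 : ℝ) ^ (√(logb 2 n) / 2)) ^ 2) ^ ⌈(2 * c + 1) * √(logb 2 n)⌉₊ ∧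
      ((4 * ⌈(2 * c + 1) * √(logb 2 n)⌉₊ : ℕ) : ℝ) *
        (4 * 8 ^ (H * (4 * ⌈(2 * c + 1) * √(logb 2 n)⌉₊)) +
          m * ((4 * 8 ^ H + M) / 2 ^ (√(logb 2 n) / 2))) ≤ θ / 2 * m := by
  have hL := tendsto_sqrt_logb_atTop
  filter_upwards [eventually_ge_atTop 1, hL.eventually (eventually_ge_atTop 1),
    hL.eventually (eventually_le_two_rpow_mul (8 ^ H) (b := 1 / 2) (by norm_num)),
    -- With `b = 0` and `L ≥ 1` this says `n ^ c ≥ 2`, which puts `m` within a factor two of `n ^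
    -- c`.
    hL.eventually (eventually_mul_two_rpow_le 2 0 hc),
    hL.eventually (eventually_mul_two_rpow_le (128 * (2 * c + 2) / θ) (24 * H * (c + 1)) hc),
    hL.eventually (eventually_mul_le_two_rpow_half
      (16 * (2 * c + 2) * (4 * 8 ^ H + M) / θ)),
    eventually_gt_atTop ⌈4 * M⌉₊] with n hn h1 h8 h2 hbig hlin hnM
  refine ⟨h1, fun m hm => ?_⟩
  set L := √(logb 2 n) with hLdef
  have hnL : (2 : ℝ) ^ (L ^ 2) = n := rpow_sqrt_logb_sq hn
  set r := ⌈(2 * c + 1) * L⌉₊ with hr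
  set N := (n : ℝ) ^ c with hN
  have hNL : (2 : ℝ) ^ (c * L ^ 2) = N := by
    rw [hN, ← hnL, ← rpow_mul two_pos.le, mul_comm]
  have hrL : (r : ℝ) ≤ (2 * c + 2) * L := by
    have := (Nat.ceil_lt_add_one (show 0 ≤ (2 * c + 1) * L by positivity)).le
    linarith
  rw [hNL] at h2 hbig
  simp only [zero_mul, rpow_zero, mul_one] at h2
  have hN2 : 2 ≤ N := by linarith
  obtain ⟨hm1, hm2⟩ := abs_lt.mp hm
  have hmlow : N / 2 ≤ m := by linarith
  have hmup : (m : ℝ) ≤ 2 * N := by linarith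
  have hmpos : (0 : ℝ) < m := by linarith
  set y := (2 : ℝ) ^ (L / 2) with hy
  have hypos : 0 < y := rpow_pos_of_pos two_pos _
  have hy2 : y ^ 2 = (2 : ℝ) ^ L := by
    rw [hy, ← rpow_natCast, ← rpow_mul two_pos.le]; norm_num
  refine ⟨by exact_mod_cast hmpos, ?_, ?_, ?_⟩
  · calc (8 : ℝ) ^ H ≤ 2 ^ (1 / 2 * L) := h8
      _ = y := by rw [hy]; ring_nf
  -- The summand `2 * c` in `r` pays for `m ^ 2`; the summand `1` gives a spare factor `n` that
  -- beats `4 * M`.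
  · have h4M : 4 * M < n := Nat.lt_of_ceil_lt hnM
    have hNN : N ^ 2 * n = (2 : ℝ) ^ (L * ((2 * c + 1) * L)) := by
      rw [← hNL, ← hnL, ← rpow_natCast, ← rpow_mul two_pos.le, ← rpow_add two_pos]
      push_cast
      ring_nf
    calc M * (m : ℝ) ^ 2 ≤ M * (2 * N) ^ 2 := by gcongr
      _ = N ^ 2 * (4 * M) := by ring
      _ < N ^ 2 * n := by gcongr
      _ = (2 : ℝ) ^ (L * ((2 * c + 1) * L)) := hNN
      _ ≤ (2 : ℝ) ^ (L * r) := by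
        refine rpow_le_rpow_of_exponent_le one_le_two ?_
        have := Nat.le_ceil ((2 * c + 1) * L)
        gcongr
      _ = (y ^ 2) ^ r := by rw [hy2, rpow_mul two_pos.le, rpow_natCast]
  · have hpow : (8 : ℝ) ^ (H * (4 * r)) ≤ (2 : ℝ) ^ (24 * H * (c + 1) * L) := by
      calc (8 : ℝ) ^ (H * (4 * r)) = (2 : ℝ) ^ ((12 * H : ℝ) * r) := by
            rw [show (8 : ℝ) = 2 ^ 3 by norm_num, ← pow_mul, ← rpow_natCast]
            push_cast
            ring_nf
        _ ≤ _ := by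
            refine rpow_le_rpow_of_exponent_le one_le_two ?_
            calc (12 * H : ℝ) * r ≤ (12 * H : ℝ) * ((2 * c + 2) * L) := by gcongr
              _ = _ := by ring
    have hfirst : (4 * r : ℝ) * (4 * 8 ^ (H * (4 * r))) ≤ θ / 4 * m := by
      calc (4 * r : ℝ) * (4 * 8 ^ (H * (4 * r)))
          ≤ (4 * ((2 * c + 2) * L)) * (4 * (2 : ℝ) ^ (24 * H * (c + 1) * L)) := by gcongr
        _ = θ / 8 * (128 * (2 * c + 2) / θ * L * (2 : ℝ) ^ (24 * H * (c + 1) * L)) := by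
            field_simp; norm_num
        _ ≤ θ / 8 * N := by gcongr
        _ ≤ θ / 4 * m := by nlinarith
    have hsecond : (4 * r : ℝ) * ((4 * 8 ^ H + M) / y) ≤ θ / 4 := by
      rw [← mul_div_assoc, div_le_iff₀ hypos]
      calc (4 * r : ℝ) * (4 * 8 ^ H + M) ≤ 4 * ((2 * c + 2) * L) * (4 * 8 ^ H + M) := by gcongr
        _ = θ / 4 * (16 * (2 * c + 2) * (4 * 8 ^ H + M) / θ * L) := by
            field_simp; norm_num
        _ ≤ θ / 4 * y := by gcongr
    push_cast
    nlinarith [mul_le_mul_of_nonneg_left hsecond hmpos.le]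

end Asymptotics

end RangeReporting

/-! ### Choice of constants and assembly of the lower bound. -/

namespace RangeReporting

open Real in
/-- Markov's inequality for the lower tail of the counts `k i`. -/
lemma mul_le_card_filter_of_sum_pow_le {m : ℕ} (hm : 0 < m) {k : Fin m → ℕ} {x θ : ℝ}
    (h : 2 ^ x / m * ∑ i, (1 / 2 : ℝ) ^ k i ≤ 1 - θ) :
    θ * m ≤ (Finset.univ.filter fun i => x ≤ (k i : ℝ)).card := by
  have hm' : (0 : ℝ) < m := by exact_mod_cast hm
  have hbad : ((Finset.univ.filter fun i => ¬ x ≤ (k i : ℝ)).card : ℝ) ≤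
      2 ^ x * ∑ i, (1 / 2 : ℝ) ^ k i := by
    rw [Finset.mul_sum, Finset.card_filter]
    push_cast
    refine Finset.sum_le_sum fun i _ => ?_
    split_ifs with h
    · positivity
    · have e : (1 / 2 : ℝ) ^ k i = 2 ^ (-(k i : ℝ)) := by
        rw [rpow_neg two_pos.le, rpow_natCast]; simp
      rw [e, ← rpow_add two_pos]
      refine one_le_rpow one_le_two ?_
      linarith [not_le.mp h]
  have htot : ((Finset.univ.filter fun i => x ≤ (k i : ℝ)).card : ℝ) +
      (Finset.univ.filter fun i => ¬ x ≤ (k i : ℝ)).card = m := by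
    have := Finset.card_filter_add_card_filter_not (s := (Finset.univ : Finset (Fin m)))
      (fun i => x ≤ (k i : ℝ))
    rw [Finset.card_univ, Fintype.card_fin] at this
    exact_mod_cast this
  rw [div_mul_eq_mul_div, div_le_iff₀ hm'] at h
  linarith

-- The weights and moments are those of the chosen point set. Since `2 ≤ e`, the weight `2 ^ (c *
-- Q)` costs only half of the exponent `2 * c * Q`.
open Real in
lemma weighted_bound_le {m n c Q y B ε : ℝ} (hm : 0 < m) (hn : 0 < n) (hc : 0 ≤ c * Q)
    (hy : 0 < y) :
    2 ^ (c * Q) / m * (m * exp (-(n * (4 * c * Q / n) / 2))) +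
      ε / m ^ 2 * (m ^ 2 * exp (n * (y ^ 2 * (B / (n * y ^ 2))))) ≤
      exp (-(c * Q)) + ε * exp B := by
  have e1 : n * (4 * c * Q / n) / 2 = 2 * (c * Q) := by field_simp; ring
  have e2 : n * (y ^ 2 * (B / (n * y ^ 2))) = B := by field_simp
  have e3 : (2 : ℝ) ^ (c * Q) ≤ exp (c * Q) := by
    rw [← exp_one_rpow]
    refine rpow_le_rpow two_pos.le ?_ hc
    linarith [add_one_le_exp (1 : ℝ)]
  have e4 : 2 ^ (c * Q) / m * (m * exp (-(2 * (c * Q)))) ≤ exp (-(c * Q)) := by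
    calc 2 ^ (c * Q) / m * (m * exp (-(2 * (c * Q)))) = 2 ^ (c * Q) * exp (-(2 * (c * Q))) := by
          field_simp
      _ ≤ exp (c * Q) * exp (-(2 * (c * Q))) := by gcongr
      _ = exp (-(c * Q)) := by rw [← exp_add]; ring_nf
  have e5 : ε / m ^ 2 * (m ^ 2 * exp B) = ε * exp B := by field_simp
  rw [e1, e2, e5]
  linarith

/-- A query with output `O` takes positive time and finds `O` along a tree of its running time. -/
lemma PointerStructure.exists_tree_of_runsTo {E : Type*} {G : PointerStructure E} {O : Finset E}
    {X : Set E} {Q C : ℝ} (hX : X = ↑O)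
    (h : ∃ (t : ℕ) (σ : Config E), G.RunsTo t σ ∧ σ.output = X ∧ (t : ℝ) ≤ Q + C * (X.ncard : ℝ)) :
    ∃ T : BinaryTree Unit, 1 ≤ Q + C * O.card ∧ (T.numNodes : ℝ) ≤ Q + C * O.card ∧
      ↑O ⊆ G.elems T (some G.root) := by
  obtain ⟨t, σ, hrun, hout, ht⟩ := h
  obtain ⟨T, hT, hsub⟩ := hrun.exists_tree
  rw [hX, Set.ncard_coe_finset] at ht
  rw [hout, hX] at hsub
  have h1 : (1 : ℝ) ≤ t := by exact_mod_cast hrun.one_le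
  have h2 : (T.numNodes : ℝ) ≤ t := by exact_mod_cast hT
  exact ⟨T, by linarith, by linarith, hsub⟩

open Real in
/-- The space lower bound for positive query time. -/
theorem exists_space_lower_bound {D : ℕ} (hD : 1 ≤ D) {c : ℝ} (hc : 0 < c) (C B : ℝ) :
    ∃ (δ A : ℝ) (n₀ : ℕ), 0 < δ ∧
      ∀ (𝓡 : Set (Set (EuclideanSpace ℝ (Fin D)))) (S Q : ℝ) (n : ℕ), n₀ ≤ n → 0 < Q →
        Admits 𝓡 n S Q C →
        ∀ (m : ℕ), |(m : ℝ) - (n : ℝ) ^ c| < 1 →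
        ∀ (l : ℝ) (K : Set (EuclideanSpace ℝ (Fin D))), 0 < l →
          IsHypercube K l →
        ∀ R : Fin m → Set (EuclideanSpace ℝ (Fin D)),
          (∀ i, R i ∈ 𝓡) →
          (∀ i, NullMeasurableSet (R i) volume) →
          (∀ i, 4 * c * l ^ D * Q / n ≤ volume.real (R i ∩ K)) →
          (∀ i j, i ≠ j → volume.real (R i ∩ R j ∩ K) ≤
            B * (l ^ D / (n * (2 : ℝ) ^ √(Real.logb 2 n)))) →
          δ * (m * Q / (2 : ℝ) ^ (A * √(Real.logb 2 n))) ≤ S := by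
  classical
  -- For `Q ≥ 1` the weighted sum is at most `exp (-c) + ε * exp B = (1 - 4θ) + 2θ = 1 - 2θ`, which
  -- leaves Markov's inequality a fraction `2θ` of good ranges.
  set θ := (1 - exp (-c)) / 4 with hθdef
  have hθ : 0 < θ := by
    have : exp (-c) < 1 := by
      rw [← exp_zero, exp_lt_exp]; linarith
    rw [hθdef]; linarith
  have hexpc : exp (-c) = 1 - 4 * θ := by rw [hθdef]; ring
  have hθ1 : θ ≤ 1 / 4 := by
    have := exp_pos (-c)
    linarith
  set ε := 2 * θ * exp (-B) with hεdef
  have hε : 0 < ε := by positivity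
  have hεB : ε * exp B = 2 * θ := by
    rw [hεdef, mul_assoc, ← exp_add]; simp
  -- For every `Q > 0` the weighted sum is at most `1 + 2θ ≤ 2`, and the pair sum enters it with
  -- weight `ε / m ^ 2`.
  set M := 2 / ε with hMdef
  have hM : 0 ≤ M := by positivity
  -- Good outputs have size at least `β * Q` whether `Q < 1` or `Q ≥ 1`; then `Q + C * k ≤ (1 / β +
  -- |C|) * k ≤ H * k`.
  set β := min 1 c with hβdef
  have hβ : 0 < β := lt_min one_pos hc
  set H := ⌈1 / β + |C|⌉₊ with hHdef
  have hHle : 1 / β + |C| ≤ H := Nat.le_ceil _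
  have hH : 0 < H := Nat.ceil_pos.mpr (by positivity)
  obtain ⟨n₀, hn₀⟩ := Filter.eventually_atTop.mp (eventually_parameters hc hM hθ H)
  set A : ℝ := 4 * (8 * (2 * c + 2) * H + 1) with hAdef
  refine ⟨θ * β / 16, A, max n₀ 1, by positivity, ?_⟩
  intro 𝓡 S Q n hn hQ hadm m hm l K hl hK R hR𝓡 hmeas hlarge hinter
  have hn1 : (0 : ℝ) < n := by exact_mod_cast (le_trans (le_max_right _ _) hn)
  obtain ⟨hL1, hpar⟩ := hn₀ n (le_trans (le_max_left _ _) hn)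
  obtain ⟨hm0, hyH, hshare, hsmall⟩ := hpar m hm
  set L := √(logb 2 n) with hL
  set r := ⌈(2 * c + 1) * L⌉₊ with hr
  set y := (2 : ℝ) ^ (L / 2) with hy
  have hypos : 0 < y := rpow_pos_of_pos two_pos _
  have hy2 : y ^ 2 = (2 : ℝ) ^ L := by
    rw [hy, ← rpow_natCast, ← rpow_mul two_pos.le]; norm_num
  have hm' : (0 : ℝ) < m := by exact_mod_cast hm0
  have hlD : 0 < l ^ D := pow_pos hl D
  -- The base `z = y ^ 2 = 2 ^ L` gives `n * z * q = B`, so the pair moments stay bounded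
  -- independently of `n`.
  obtain ⟨P, hPn, hPK, hP⟩ := hK.exists_points hl hD hmeas (p := 4 * c * Q / n)
    (q := B / (n * y ^ 2)) (z := y ^ 2) (w₁ := 2 ^ (c * Q) / m) (w₂ := ε / m ^ 2)
    (fun i => by
      refine le_of_eq_of_le ?_ (hlarge i)
      ring)
    (fun i j hij => by
      refine (hinter i j hij).trans_eq ?_
      rw [hy2]; ring)
    (by rw [hy2]; exact one_le_rpow one_le_two (by linarith)) (by positivity) (by positivity) n
  replace hP := hP.trans (weighted_bound_le (B := B) (ε := ε) hm' hn1 (by positivity) hypos)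
  rw [hεB] at hP
  obtain ⟨G, hGS, hG⟩ := hadm P hPn
  set O : Fin m → Finset (EuclideanSpace ℝ (Fin D)) := fun i => P.filter (· ∈ R i) with hO
  have hOcoe : ∀ i, ((↑P : Set (EuclideanSpace ℝ (Fin D))) ∩ R i) = ↑(O i) := by
    intro i; ext x; rw [Finset.mem_coe, Finset.mem_filter]; rfl
  have hOcard : ∀ i, ((↑P : Set (EuclideanSpace ℝ (Fin D))) ∩ R i).ncard = (O i).card := by
    intro i; rw [hOcoe, Set.ncard_coe_finset]
  have hOinter : ∀ i j, ((↑P : Set (EuclideanSpace ℝ (Fin D))) ∩ (R i ∩ R j)).ncard =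
      (O i ∩ O j).card := by
    intro i j
    rw [← Set.ncard_coe_finset, Finset.coe_inter, ← hOcoe, ← hOcoe, Set.inter_inter_distrib_left]
  simp only [hOcard, hOinter] at hP
  have hsum1 : 0 ≤ 2 ^ (c * Q) / m * ∑ i, (1 / 2 : ℝ) ^ (O i).card :=
    mul_nonneg (by positivity) (Finset.sum_nonneg fun _ _ => by positivity)
  have hcQ : 0 < c * Q := mul_pos hc hQ
  have hθm : 0 < θ * m := mul_pos hθ hm'
  have hpairs : ∑ x ∈ (Finset.univ : Finset (Fin m)).offDiag, (y ^ 2) ^ (O x.1 ∩ O x.2).card ≤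
      M * (m : ℝ) ^ 2 := by
    have h1 : exp (-(c * Q)) ≤ 1 := exp_le_one_iff.mpr (by linarith)
    have h2 : ε / m ^ 2 * ∑ x ∈ (Finset.univ : Finset (Fin m)).offDiag,
        (y ^ 2) ^ (O x.1 ∩ O x.2).card ≤ 2 := by linarith
    rw [div_mul_eq_mul_div, div_le_iff₀ (by positivity)] at h2
    rw [hMdef, div_mul_eq_mul_div, le_div_iff₀ hε]
    linarith
  have hrun : ∀ i, ∃ T : BinaryTree Unit, 1 ≤ Q + C * (O i).card ∧
      (T.numNodes : ℝ) ≤ Q + C * (O i).card ∧ ↑(O i) ⊆ G.elems T (some G.root) :=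
    fun i => PointerStructure.exists_tree_of_runsTo (hOcoe i) (hG (R i) (hR𝓡 i))
  have hgood : ∃ I : Finset (Fin m), θ * m ≤ I.card ∧
      ∀ i ∈ I, 1 ≤ (O i).card ∧ β * Q ≤ (O i).card := by
    -- For `Q < 1` Markov's inequality may give nothing, but an empty output would need time at
    -- least `1 > Q`; so every range is good.
    rcases lt_or_ge Q 1 with hQ1 | hQ1
    · refine ⟨Finset.univ, ?_, fun i _ => ?_⟩
      · rw [Finset.card_univ, Fintype.card_fin]
        exact mul_le_of_le_one_left hm'.le (by linarith)
      have h1 : 1 ≤ (O i).card := by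
        by_contra! h0
        obtain ⟨T, h1, -⟩ := hrun i
        rw [Nat.lt_one_iff.mp h0] at h1
        simp only [Nat.cast_zero, mul_zero] at h1
        linarith
      refine ⟨h1, ?_⟩
      have h1' : (1 : ℝ) ≤ (O i).card := by exact_mod_cast h1
      calc β * Q ≤ 1 * Q := by
            gcongr
            exact min_le_left _ _
        _ ≤ (O i).card := by linarith
    · refine ⟨Finset.univ.filter fun i => c * Q ≤ (O i).card, ?_, fun i hi => ?_⟩
      · have h1 : exp (-(c * Q)) ≤ 1 - 4 * θ := by
          rw [← hexpc, exp_le_exp]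
          linarith [mul_le_mul_of_nonneg_left hQ1 hc.le]
        have h2 : 0 ≤ ε / m ^ 2 * ∑ x ∈ (Finset.univ : Finset (Fin m)).offDiag,
          (y ^ 2) ^ (O x.1 ∩ O x.2).card :=
          mul_nonneg (by positivity) (Finset.sum_nonneg fun _ _ => by positivity)
        have h3 : 2 ^ (c * Q) / m * ∑ i, (1 / 2 : ℝ) ^ (O i).card ≤ 1 - 2 * θ := by linarith
        have h4 := mul_le_card_filter_of_sum_pow_le hm0 h3
        have h5 : θ * m ≤ 2 * θ * m := by linarith
        exact h5.trans h4
      · have hk : c * Q ≤ (O i).card := (Finset.mem_filter.mp hi).2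
        have hpos : (0 : ℝ) < (O i).card := lt_of_lt_of_le (by positivity) hk
        refine ⟨by exact_mod_cast hpos, le_trans ?_ hk⟩
        have : β ≤ c := min_le_right _ _
        gcongr
  obtain ⟨I, hIcard, hI⟩ := hgood
  have htree : ∀ i ∈ I, ∃ T : BinaryTree Unit, T.numNodes ≤ H * (O i).card ∧
      ↑(O i) ⊆ G.elems T (some G.root) := by
    intro i hi
    obtain ⟨T, -, hT, hsub⟩ := hrun i
    refine ⟨T, ?_, hsub⟩
    have hQk : Q ≤ 1 / β * (O i).card := by
      rw [one_div_mul_eq_div, le_div_iff₀ hβ]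
      linarith [(hI i hi).2]
    have hCk : C * (O i).card ≤ |C| * (O i).card :=
      mul_le_mul_of_nonneg_right (le_abs_self C) (Nat.cast_nonneg _)
    have : (T.numNodes : ℝ) ≤ H * (O i).card := by
      calc (T.numNodes : ℝ) ≤ (1 / β + |C|) * (O i).card := by linarith
        _ ≤ H * (O i).card := mul_le_mul_of_nonneg_right hHle (Nat.cast_nonneg _)
    exact_mod_cast this
  have hr0 : 0 < r := Nat.ceil_pos.mpr (by positivity)
  have hkey := PointerStructure.mul_le_mul_space (G := G) hm0 hr0 hH (fun i hi => (hI i hi).1)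
    htree hM hypos hyH hpairs hshare hIcard hsmall (q := β * Q) (by positivity)
    (fun i hi => (hI i hi).2)
  have hpow : (16 : ℝ) ^ (8 * r * H + 1) ≤ (2 : ℝ) ^ (A * L) := by
    have hrL : (r : ℝ) ≤ (2 * c + 2) * L := by
      have := (Nat.ceil_lt_add_one (show 0 ≤ (2 * c + 1) * L by positivity)).le
      linarith
    calc (16 : ℝ) ^ (8 * r * H + 1) = (2 : ℝ) ^ (4 * (8 * r * H + 1) : ℝ) := by
          rw [show (16 : ℝ) = 2 ^ 4 by norm_num, ← pow_mul, ← rpow_natCast]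
          push_cast
          ring_nf
      _ ≤ _ := by
          refine rpow_le_rpow_of_exponent_le one_le_two ?_
          calc (4 * (8 * r * H + 1) : ℝ) ≤ 4 * (8 * ((2 * c + 2) * L) * H + L) := by gcongr
            _ = A * L := by rw [hAdef]; ring
  have hApos : (0 : ℝ) < 2 ^ (A * L) := rpow_pos_of_pos two_pos _
  refine le_trans ?_ hGS
  rw [← mul_div_assoc, div_le_iff₀ hApos]
  have hGpos : (0 : ℝ) ≤ G.space := Nat.cast_nonneg _
  have : 8 * 16 ^ (8 * r * H + 1) * (G.space : ℝ) ≤ 8 * 2 ^ (A * L) * (G.space : ℝ) := by gcongr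
  linarith

/-- The space bound of a range reporting structure is nonnegative. -/
lemma Admits.nonneg {E : Type*} [Infinite E] {𝓡 : Set (Set E)} {n : ℕ} {S Q C : ℝ}
    (h : Admits 𝓡 n S Q C) : 0 ≤ S := by
  obtain ⟨P, hP⟩ := Infinite.exists_subset_card_eq E n
  obtain ⟨G, hG, -⟩ := h P hP
  exact (Nat.cast_nonneg _).trans hG

end RangeReporting

theorem mainTheorem1 (D : ℕ) (hD : 1 ≤ D) (c : ℝ) (hc : 0 < c) (C B : ℝ) :
    ∃ (δ A : ℝ) (n₀ : ℕ), 0 < δ ∧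
      ∀ (𝓡 : Set (Set (EuclideanSpace ℝ (Fin D)))) (S Q : ℕ → ℝ) (n : ℕ), n₀ ≤ n →
        RangeReporting.Admits 𝓡 n (S n) (Q n) C →
        ∀ (m : ℕ), |(m : ℝ) - (n : ℝ) ^ c| < 1 →
        ∀ (l : ℝ) (K : Set (EuclideanSpace ℝ (Fin D))), 0 < l →
          RangeReporting.IsHypercube K l →
        ∀ R : Fin m → Set (EuclideanSpace ℝ (Fin D)),
          (∀ i, R i ∈ 𝓡) →
          (∀ i, NullMeasurableSet (R i) volume) →
          (∀ i, 4 * c * l ^ D * Q n / n ≤ volume.real (R i ∩ K)) →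
          (∀ i j, i ≠ j → volume.real (R i ∩ R j ∩ K) ≤
            B * (l ^ D / (n * (2 : ℝ) ^ √(Real.logb 2 n)))) →
          δ * (m * Q n / (2 : ℝ) ^ (A * √(Real.logb 2 n))) ≤ S n := by
  obtain ⟨δ, A, n₀, hδ, h⟩ := RangeReporting.exists_space_lower_bound hD hc C B
  refine ⟨δ, A, n₀, hδ, ?_⟩
  intro 𝓡 S Q n hn hadm m hm l K hl hK R hR𝓡 hmeas hlarge hinter
  -- For `Q n ≤ 0` the claimed bound is nonpositive, while a space bound is never negative.
  rcases le_or_gt (Q n) 0 with hQ | hQ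
  · have : Nonempty (Fin D) := ⟨⟨0, hD⟩⟩
    refine le_trans ?_ hadm.nonneg
    refine mul_nonpos_of_nonneg_of_nonpos hδ.le (div_nonpos_of_nonpos_of_nonneg ?_ (by positivity))
    exact mul_nonpos_of_nonneg_of_nonpos (Nat.cast_nonneg _) hQ
  · exact h 𝓡 (S n) (Q n) n hn hQ hadm m hm l K hl hK R hR𝓡 hmeas hlarge hinter
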